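/- For integers $n, d \ge 1$ with $nd$ even, let $\mathcal{G}_{n,d}$ be the random $d$-regular multigraph on $n$ labelled vertices given by the configuration model: each vertex emits $d$ distinct half-edges, the $nd$ half-edges are paired up uniformly at random, and each pair is glued to an edge (loops and multiple edges are allowed). For a finite multigraph $G$ and an integer $\tau \ge 1$ let $$\alpha^{\tau}(G) = \max\left\{ \frac{|S|}{|V(G)|} : S \subseteq V(G),\ \text{every connected component of the induced subgraph } G[S] \text{ has at most } \tau \text{ vertices} \right\}.$$ Then for every $\epsilon > 0$ there is a $d_0 = d_0(\epsilon)$, depending on $\epsilon$ only, such that for every integer $\tau \ge 1$ (fixed with respect to $n$) and every integer $d \ge d_0$, $$\mathbb{P}\left( \alpha^{\tau}(\mathcal{G}_{n,d}) \le (2+\epsilon)\, \frac{\log d}{d} \right) \longrightarrow 1 \quad \text{as } n \to \infty,$$ where $n$ runs through the integers for which $nd$ is even and $\log$ is the natural logarithm. -/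

import Mathlib

open Filter Topology MeasureTheory ProbabilityTheory

namespace SmallClusters

noncomputable section

/-- The set of vertices of the connected component of the vertex `x` in the multigraph `H`. -/
def component {α β : Type*} (H : Graph α β) (x : α) : Set α :=
  {y | y ∈ H.vertexSet ∧ Relation.ReflTransGen H.Adj x y}

/-- `S ⊆ V(G)` is a percolation set with clusters of size at most `τ`: every component of the
induced subgraph `G[S]` has at most `τ` vertices. -/
def IsPercolationSet {α β : Type*} (G : Graph α β) (τ : ℕ) (S : Set α) : Prop :=
  S ⊆ G.vertexSet ∧ ∀ x ∈ S, (component (G.induce S) x).encard ≤ (τ : ℕ∞)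

/-- `α^τ(G)`, for a finite multigraph `G`: the largest density `|S| / |V(G)|` of a percolation set
`S` with clusters of size at most `τ`. (For finite `G` the supremum is a maximum, as there are
finitely many such `S`, the empty set being one.) -/
def percDensity {α β : Type*} (τ : ℕ) (G : Graph α β) : ℝ :=
  sSup {r : ℝ | ∃ S : Set α, IsPercolationSet G τ S ∧
    r = (S.ncard : ℝ) / (G.vertexSet.ncard : ℝ)}

/-- The half-edges: each of the `n` labelled vertices emits `d` distinct ones; `(v, i)` is the
`i`-th half-edge at `v`. -/
abbrev HalfEdge (n d : ℕ) : Type := Fin n × Fin d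

/-- The pairings (perfect matchings) of the `n * d` half-edges, each given by the map that takes a
half-edge to its partner, an involution without fixed points. -/
def Pairing (n d : ℕ) : Type :=
  {σ : Equiv.Perm (HalfEdge n d) // ∀ h, σ (σ h) = h ∧ σ h ≠ h}

instance (n d : ℕ) : MeasurableSpace (Pairing n d) := ⊤

/-- The multigraph on the vertices `0, …, n - 1` obtained from a pairing: each pair
`{h, σ h}` of half-edges is glued to an edge, between the vertices that emit `h` and `σ h`. -/
def Pairing.toGraph {n d : ℕ} (σ : Pairing n d) : Graph (Fin n) (Sym2 (HalfEdge n d)) where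
  vertexSet := Set.univ
  IsLink e u v := ∃ h : HalfEdge n d, e = s(h, σ.1 h) ∧ u = h.1 ∧ v = (σ.1 h).1
  isLink_symm := by
    intro e _
    refine ⟨?_⟩
    rintro u v ⟨h, rfl, rfl, rfl⟩
    refine ⟨σ.1 h, ?_, rfl, ?_⟩
    · rw [(σ.2 h).1]; exact Sym2.eq_swap
    · rw [(σ.2 h).1]
  eq_or_eq_of_isLink_of_isLink := by
    rintro e x y v w ⟨h, rfl, rfl, rfl⟩ ⟨k, hk, rfl, rfl⟩
    rcases Sym2.eq_iff.mp hk with ⟨h1, _⟩ | ⟨h1, _⟩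
    · left; rw [h1]
    · right; rw [h1]
  left_mem_of_isLink := fun _ _ _ _ => Set.mem_univ _

/-- The configuration model: the uniform distribution on the pairings of the half-edges, a
probability measure as soon as `n * d` is even. The random `d`-regular multigraph `G_{n,d}` is
`σ.toGraph` for a random `σ` with this distribution. -/
def configurationModel (n d : ℕ) : Measure (Pairing n d) :=
  uniformOn Set.univ

end

end SmallClusters

set_option linter.unusedSectionVars false

/-! The proof is a first moment bound over the vertex sets `S` of size `k = ⌈β n⌉`, with `β = (2 +
ε) log d / d`. For fixed `S`, the pairings whose components inside `S` have at most `τ` vertices are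
counted by revealing the partner of one half-edge at `S` at a time, while the vertices carry labels
for the clusters built so far. A partner outside `S` is the typical case. A partner in `S` with the
same label is rare: a cluster has at most `τ` vertices, so there are at most `τ d` such partners.
Any other partner in `S` merges two clusters, which can happen fewer than `k` times if `S` is
nonempty. Hence the potential `θ⁻¹ ^ (number of clusters) * weight`, where `weight` is roughly the
`c`-th power of the probability that `S` spans no edge: each merger gains a factor `θ`, and the
slack `1 - c` pays for it (`weight_step_le`). Same-label partners accumulate only a factor
polynomial in `n` (`card_admissible_le`). Up to that polynomial, the expected number of sets is at
most `exp (k (2 - log β - log θ - c β d / 2))`. Here `c β d / 2 = (1 + ε / 4) log d` beats `-log β ≤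
log d`, and `θ` is a constant depending on `ε` only. The size `τ` enters only the exponent of the
polynomial, so `d₀` does not depend on it. -/

namespace SmallClusters

/-! ### Counting perfect matchings by removing a pair -/

section Pairings

open Finset Equiv

variable {H V : Type*} [Fintype H] [DecidableEq H] [DecidableEq V]

/-- The perfect matchings of the finite set `U`, as involutions moving exactly the points of `U`. -/
def pairingsOn (U : Finset H) : Finset (Perm H) :=
  univ.filter fun σ => (∀ x, σ (σ x) = x) ∧ σ.support = U

/-- The number of perfect matchings of a set with `m` elements. -/
def numPairings : ℕ → ℕ
  | 0 => 1
  | 1 => 0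
  | m + 2 => (m + 1) * numPairings m

theorem numPairings_pos {m : ℕ} (h : Even m) : 0 < numPairings m := by
  obtain ⟨k, rfl⟩ := h
  induction k with
  | zero => simp [numPairings]
  | succ k ih =>
    have : k + 1 + (k + 1) = (k + k) + 2 := by ring
    rw [this, numPairings]
    positivity

theorem mem_pairingsOn {U : Finset H} {σ : Perm H} :
    σ ∈ pairingsOn U ↔ (∀ x, σ (σ x) = x) ∧ ∀ x, σ x ≠ x ↔ x ∈ U := by
  simp [pairingsOn, Finset.ext_iff]

theorem apply_mem_erase {U : Finset H} {σ : Perm H} (hσ : σ ∈ pairingsOn U) {a : H} (ha : a ∈ U) :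
    σ a ∈ U.erase a := by
  rw [mem_pairingsOn] at hσ
  have h1 : σ a ≠ a := (hσ.2 a).2 ha
  refine mem_erase.2 ⟨h1, (hσ.2 _).1 ?_⟩
  rw [hσ.1]; exact h1.symm

/-- Multiplying by the transposition of a matched pair makes both its points fixed and changes
nothing else: the pair is deleted. `swap_mul_mem_pairingsOn` is the inverse operation. -/
theorem swap_mul_mem_pairingsOn_erase {U : Finset H} {σ : Perm H} (hσ : σ ∈ pairingsOn U) {a : H}
    (ha : a ∈ U) : swap a (σ a) * σ ∈ pairingsOn ((U.erase a).erase (σ a)) := by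
  have h0 := mem_erase.1 (apply_mem_erase hσ ha)
  rw [mem_pairingsOn] at hσ ⊢
  have key : ∀ x, (swap a (σ a) * σ) x = if x = a ∨ x = σ a then x else σ x := by
    intro x
    rw [Perm.mul_apply]
    by_cases h1 : x = a
    · simp [h1]
    by_cases h2 : x = σ a
    · simp [h2, hσ.1]
    · have h3 : σ x ≠ a := fun h => h2 (by rw [← h, hσ.1])
      have h4 : σ x ≠ σ a := fun h => h1 (σ.injective h)
      simp [h1, h2, swap_apply_of_ne_of_ne h3 h4]
  constructor
  · intro x
    rw [key x]
    split_ifs with h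
    · rw [key x, if_pos h]
    · push Not at h
      have h3 : σ x ≠ a := fun h' => h.2 (by rw [← h', hσ.1])
      have h4 : σ x ≠ σ a := fun h' => h.1 (σ.injective h')
      rw [key, if_neg (by tauto), hσ.1]
  · intro x
    rw [key x, mem_erase, mem_erase]
    split_ifs with h
    · simp; tauto
    · rw [hσ.2 x]; tauto

theorem swap_mul_mem_pairingsOn {U : Finset H} {a b : H} (ha : a ∈ U) (hb : b ∈ U.erase a)
    {ρ : Perm H} (hρ : ρ ∈ pairingsOn ((U.erase a).erase b)) :
    swap a b * ρ ∈ pairingsOn U ∧ (swap a b * ρ) a = b := by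
  rw [mem_pairingsOn] at hρ ⊢
  have hb' := mem_erase.1 hb
  have hra : ρ a = a := by by_contra h; have := (hρ.2 a).1 h; simp at this
  have hrb : ρ b = b := by by_contra h; have := (hρ.2 b).1 h; simp at this
  have key : ∀ x, (swap a b * ρ) x = if x = a then b else if x = b then a else ρ x := by
    intro x
    rw [Perm.mul_apply]
    split_ifs with h1 h2
    · simp [h1, hra]
    · simp [h2, hrb]
    · have h3 : ρ x ≠ a := fun h => h1 (ρ.injective (h.trans hra.symm))
      have h4 : ρ x ≠ b := fun h => h2 (ρ.injective (h.trans hrb.symm))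
      exact swap_apply_of_ne_of_ne h3 h4
  refine ⟨⟨fun x => ?_, fun x => ?_⟩, by simp [key]⟩
  · rw [key x]
    split_ifs with h1 h2
    · simp [key, h1, hb'.1]
    · simp [key, h2]
    · have h3 : ρ x ≠ a := fun h => h1 (ρ.injective (h.trans hra.symm))
      have h4 : ρ x ≠ b := fun h => h2 (ρ.injective (h.trans hrb.symm))
      simp [key, h3, h4, hρ.1]
  · rw [key x]
    split_ifs with h1 h2
    · subst h1; exact ⟨fun _ => ha, fun _ => hb'.1⟩
    · subst h2; exact ⟨fun _ => hb'.2, fun _ => hb'.1.symm⟩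
    · rw [hρ.2 x]; simp [h1, h2]

theorem card_erase_erase {U : Finset H} {a b : H} (ha : a ∈ U) (hb : b ∈ U.erase a) :
    #((U.erase a).erase b) + 2 = #U := by
  have h1 := card_erase_add_one ha
  have h2 := card_erase_add_one hb
  omega

theorem card_pairingsOn (U : Finset H) : #(pairingsOn U) = numPairings #U := by
  induction hm : #U using Nat.strong_induction_on generalizing U with
  | _ m ih =>
  rcases U.eq_empty_or_nonempty with rfl | ⟨a, ha⟩
  · obtain rfl : m = 0 := by simpa using hm.symm
    rw [numPairings, card_eq_one]
    refine ⟨1, ?_⟩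
    ext σ
    simp only [mem_pairingsOn, mem_singleton]
    constructor
    · rintro ⟨-, h⟩
      ext x
      by_contra hx
      simpa using (h x).1 hx
    · rintro rfl
      simp
  · have hmaps : Set.MapsTo (fun σ : Perm H => σ a) (pairingsOn U) (U.erase a : Finset H) :=
      fun σ hσ => apply_mem_erase hσ ha
    rw [card_eq_sum_card_fiberwise hmaps]
    have hfib : ∀ b ∈ U.erase a, #{σ ∈ pairingsOn U | σ a = b} = numPairings (m - 2) := by
      intro b hb
      have hc := card_erase_erase ha hb
      rw [← ih (m - 2) (by omega) ((U.erase a).erase b) (by omega)]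
      refine card_bij' (fun σ _ => swap a b * σ) (fun σ _ => swap a b * σ) ?_ ?_ ?_ ?_
      · intro σ hσ
        obtain ⟨h1, rfl⟩ := mem_filter.1 hσ
        exact swap_mul_mem_pairingsOn_erase h1 ha
      · intro ρ hρ
        exact mem_filter.2 (swap_mul_mem_pairingsOn ha hb hρ)
      · intro σ _; simp [← mul_assoc]
      · intro σ _; simp [← mul_assoc]
    rw [sum_congr rfl hfib, sum_const, card_erase_of_mem ha, hm, smul_eq_mul]
    obtain _ | _ | m := m
    · simp at hm; simp [hm] at ha
    · simp [numPairings]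
    · simp [numPairings]

/-! ### Cluster labels under removal of a pair -/

/-- The labelling `f` of the vertices, together with the edges that the pairing `σ` of the
half-edges creates inside `S`, generates only classes of at most `τ` vertices of `S`: some
labelling `g` coarser than `f` is constant along these edges and has only small classes. -/
def Admissible (v : H → V) (S : Finset V) (τ : ℕ) (f : V → V) (σ : Perm H) : Prop :=
  ∃ g : V → V, (∀ x ∈ S, ∀ y ∈ S, f x = f y → g x = g y) ∧
    (∀ h, v h ∈ S → v (σ h) ∈ S → g (v h) = g (v (σ h))) ∧
    ∀ x ∈ S, #{y ∈ S | g y = g x} ≤ τ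

/-- The labelling obtained from `f` by merging the class of `y` into that of `x`. -/
def mergeLabels (f : V → V) (x y : V) : V → V := fun z => if f z = f y then f x else f z

theorem image_mergeLabels {S : Finset V} {f : V → V} {x y : V} (hx : x ∈ S) (hy : y ∈ S)
    (hxy : f y ≠ f x) : #(S.image (mergeLabels f x y)) + 1 = #(S.image f) := by
  rw [← card_erase_add_one (mem_image_of_mem f hy)]
  congr 2
  ext z
  simp only [mem_image, mem_erase, mergeLabels]
  constructor
  · rintro ⟨w, hw, rfl⟩
    split_ifs with h
    · exact ⟨hxy.symm, x, hx, rfl⟩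
    · exact ⟨h, w, hw, rfl⟩
  · rintro ⟨h, w, hw, rfl⟩
    exact ⟨w, hw, if_neg h⟩

theorem Admissible.swap_mul {v : H → V} {S : Finset V} {τ : ℕ} {f : V → V} {σ : Perm H}
    (h : Admissible v S τ f σ) (hσ : ∀ x, σ (σ x) = x) (a : H) :
    Admissible v S τ f (swap a (σ a) * σ) := by
  obtain ⟨g, h1, h2, h3⟩ := h
  refine ⟨g, h1, fun x hx hx' => ?_, h3⟩
  rw [Perm.mul_apply] at hx' ⊢
  by_cases hxa : x = a
  · simp [hxa]
  by_cases hxb : x = σ a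
  · simp [hxb, hσ]
  · have h3 : σ x ≠ a := fun h => hxb (by rw [← h, hσ])
    have h4 : σ x ≠ σ a := fun h => hxa (σ.injective h)
    rw [swap_apply_of_ne_of_ne h3 h4] at hx' ⊢
    exact h2 x hx hx'

/-- The witness `g` is already constant along the edge of `a` and `σ a`, so it remains coarser than
`f` after the two end classes are merged. The deleted edge is now recorded in the labels. -/
theorem Admissible.swap_mul_mergeLabels {v : H → V} {S : Finset V} {τ : ℕ} {f : V → V}
    {σ : Perm H} (h : Admissible v S τ f σ) (hσ : ∀ x, σ (σ x) = x) {a : H} (ha : v a ∈ S)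
    (hb : v (σ a) ∈ S) :
    Admissible v S τ (mergeLabels f (v a) (v (σ a))) (swap a (σ a) * σ) := by
  obtain ⟨g, h1, h2, h3⟩ := h
  have hab := h2 a ha hb
  refine ⟨g, fun x hx y hy hxy => ?_, fun x hx hx' => ?_, h3⟩
  · simp only [mergeLabels] at hxy
    split_ifs at hxy with p q q
    · exact h1 x hx y hy (p.trans q.symm)
    · rw [h1 x hx _ hb p, h1 y hy _ ha hxy.symm, hab]
    · rw [h1 y hy _ hb q, h1 x hx _ ha hxy, hab]
    · exact h1 x hx y hy hxy
  · rw [Perm.mul_apply] at hx' ⊢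
    by_cases hxa : x = a
    · simp [hxa]
    by_cases hxb : x = σ a
    · simp [hxb, hσ]
    · have h3 : σ x ≠ a := fun h => hxb (by rw [← h, hσ])
      have h4 : σ x ≠ σ a := fun h => hxa (σ.injective h)
      rw [swap_apply_of_ne_of_ne h3 h4] at hx' ⊢
      exact h2 x hx hx'

theorem Admissible.card_class_le {v : H → V} {S : Finset V} {τ : ℕ} {f : V → V} {σ : Perm H}
    (h : Admissible v S τ f σ) {x : V} (hx : x ∈ S) : #{y ∈ S | f y = f x} ≤ τ := by
  obtain ⟨g, h1, -, h3⟩ := h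
  refine (card_le_card fun y hy => ?_).trans (h3 x hx)
  rw [mem_filter] at hy ⊢
  exact ⟨hy.1, h1 y hy.1 x hx hy.2⟩

end Pairings

/-! ### Analytic estimates for one step of the exposure -/

noncomputable section Weights

/-- The Gaussian factor of the first moment bound, for `s` half-edges in the set out of `N`. -/
def weight (c N s : ℝ) : ℝ := Real.exp (-(c * (s * (s - 1) / (2 * N))))

theorem weight_pos (c N s : ℝ) : 0 < weight c N s := Real.exp_pos _

/-- The first term is at most `exp (-(1 - c) p) ≤ 1 - (1 - c) p / 2`, and `θ` is small enough for
the second to fit into the remaining `(1 - c) p / 2`. -/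
theorem one_sub_mul_exp_add_le {c θ p : ℝ} (hc0 : 0 ≤ c) (hc1 : c ≤ 1) (hθ0 : 0 ≤ θ)
    (hθ : θ * Real.exp 2 ≤ (1 - c) / 2) (hp0 : 0 ≤ p) (hp1 : p ≤ 1) :
    (1 - p) * Real.exp (c * p) + θ * p * Real.exp (2 * (c * p)) ≤ 1 := by
  have hcp : c * p ≤ 1 := by nlinarith
  have h1 : (1 - p) * Real.exp (c * p) ≤ 1 - (1 - c) * p / 2 := by
    set x := (1 - c) * p with hx
    have hx0 : 0 ≤ x := mul_nonneg (by linarith) hp0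
    have hx1 : x ≤ 1 := by nlinarith
    have h2 : 1 - p ≤ Real.exp (-p) := by linarith [Real.add_one_le_exp (-p)]
    have h3 : (1 - p) * Real.exp (c * p) ≤ Real.exp (-x) := by
      calc _ ≤ Real.exp (-p) * Real.exp (c * p) := by gcongr
        _ = Real.exp (-x) := by rw [← Real.exp_add]; congr 1; rw [hx]; ring
    have h4 : Real.exp (-x) * Real.exp x = 1 := by rw [← Real.exp_add]; simp
    have h5 : Real.exp (-x) * (1 + x) ≤ 1 := by
      have := Real.add_one_le_exp x
      nlinarith [Real.exp_pos (-x)]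
    -- From `exp (-x) ≤ 1 / (1 + x)` and `x ≤ 1`.
    have h6 : Real.exp (-x) ≤ 1 - x / 2 := by
      by_contra! h
      nlinarith
    linarith
  have h2 : θ * p * Real.exp (2 * (c * p)) ≤ (1 - c) * p / 2 := by
    have : Real.exp (2 * (c * p)) ≤ Real.exp 2 := Real.exp_le_exp.2 (by linarith)
    calc _ ≤ θ * p * Real.exp 2 := by gcongr
      _ = p * (θ * Real.exp 2) := by ring
      _ ≤ p * ((1 - c) / 2) := by gcongr
      _ = _ := by ring
  linarith

/-- One exposure step with `u` free half-edges, `s` of them at `S`: the three terms are partners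
outside `S`, the `o` partners in the same cluster, and partners in another cluster, discounted by
`θ`. With `p` the fraction of partners in `S`, the first and third sum to at most `u - 1`, relative
to `weight c N s`. Each same-cluster partner costs at most `exp 2 < 9`. -/
theorem weight_step_le {c θ u s N o K : ℝ} (hc0 : 0 ≤ c) (hc1 : c ≤ 1) (hθ0 : 0 ≤ θ)
    (hθ : θ * Real.exp 2 ≤ (1 - c) / 2) (hu : 2 ≤ u) (hs : 1 ≤ s) (hsu : s ≤ u) (huN : u ≤ N)
    (ho : 0 ≤ o) (hoK : o ≤ K) :
    (u - s) * weight c N (s - 1) + o * weight c N (s - 2)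
      + (s - 1 - o) * (θ * weight c N (s - 2)) ≤ weight c N s * (u - 1 + 9 * K) := by
  set p := (s - 1) / (u - 1) with hp
  have hu1 : 0 < u - 1 := by linarith
  have hp0 : 0 ≤ p := div_nonneg (by linarith) hu1.le
  have hp1 : p ≤ 1 := (div_le_one hu1).2 (by linarith)
  have hpu : p * (u - 1) = s - 1 := div_mul_cancel₀ _ hu1.ne'
  have hpN : (s - 1) / N ≤ p := div_le_div_of_nonneg_left (by linarith) hu1 (by linarith)
  have hN : 0 < N := by linarith
  have hW := weight_pos c N s
  have e1 : weight c N (s - 1) ≤ weight c N s * Real.exp (c * p) := by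
    have : weight c N (s - 1) = weight c N s * Real.exp (c * ((s - 1) / N)) := by
      rw [weight, weight, ← Real.exp_add]; congr 1; field_simp; ring
    rw [this]
    gcongr
  have e2 : weight c N (s - 2) ≤ weight c N s * Real.exp (2 * (c * p)) := by
    have : weight c N (s - 2) = weight c N s * Real.exp (c * (2 * ((s - 1) / N) - 1 / N)) := by
      rw [weight, weight, ← Real.exp_add]; congr 1; field_simp; ring
    rw [this]
    have : 0 ≤ 1 / N := by positivity
    have : c * (2 * ((s - 1) / N) - 1 / N) ≤ 2 * (c * p) := by
      rw [mul_left_comm]; gcongr; linarith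
    gcongr
  have e3 : weight c N (s - 2) ≤ weight c N s * 9 := by
    refine e2.trans ?_
    gcongr
    have h1 : Real.exp (2 * (c * p)) ≤ Real.exp 2 := Real.exp_le_exp.2 (by nlinarith)
    have h2 : Real.exp 2 = Real.exp 1 * Real.exp 1 := by rw [← Real.exp_add]; norm_num
    nlinarith [Real.exp_one_lt_d9, Real.exp_pos 1]
  have key := one_sub_mul_exp_add_le hc0 hc1 hθ0 hθ hp0 hp1
  have hW2 := weight_pos c N (s - 2)
  calc _ ≤ (u - s) * weight c N (s - 1) + K * weight c N (s - 2)
      + (s - 1) * (θ * weight c N (s - 2)) := by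
        have h1 : o * weight c N (s - 2) ≤ K * weight c N (s - 2) := by gcongr
        have h2 : (s - 1 - o) * (θ * weight c N (s - 2)) ≤ (s - 1) * (θ * weight c N (s - 2)) :=
          mul_le_mul_of_nonneg_right (by linarith) (by positivity)
        linarith
    _ ≤ (u - s) * (weight c N s * Real.exp (c * p)) + K * (weight c N s * 9)
      + (s - 1) * (θ * (weight c N s * Real.exp (2 * (c * p)))) := by
        have : 0 ≤ u - s := by linarith
        have : 0 ≤ s - 1 := by linarith
        have : 0 ≤ K := ho.trans hoK
        gcongr
    _ = weight c N s * ((u - 1) * ((1 - p) * Real.exp (c * p)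
          + θ * p * Real.exp (2 * (c * p))) + 9 * K) := by
        have : u - s = (u - 1) * (1 - p) := by linarith
        rw [this, ← hpu]; ring
    _ ≤ weight c N s * ((u - 1) * 1 + 9 * K) := by gcongr
    _ = _ := by ring

/-- By Bernoulli's inequality, a polynomial factor absorbs the additive error `K` of a step that
uses up two half-edges. -/
theorem add_mul_pow_le {m K : ℕ} :
    ((m : ℝ) + 1 + K) * ((m : ℝ) + 1) ^ K ≤ ((m : ℝ) + 1) * ((m : ℝ) + 3) ^ K := by
  have hm : (0 : ℝ) < (m : ℝ) + 1 := by positivity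
  have h := one_add_mul_le_pow (a := 2 / ((m : ℝ) + 1)) (by
    have : 0 ≤ 2 / ((m : ℝ) + 1) := by positivity
    linarith) K
  have h3 : (m : ℝ) + 3 = (m + 1) * (1 + 2 / ((m : ℝ) + 1)) := by field_simp; ring
  rw [h3, mul_pow]
  calc _ ≤ (((m : ℝ) + 1) * (1 + K * (2 / ((m : ℝ) + 1)))) * ((m : ℝ) + 1) ^ K := by
        gcongr
        field_simp
        have : (0 : ℝ) ≤ K := by positivity
        linarith
    _ ≤ (((m : ℝ) + 1) * (1 + 2 / ((m : ℝ) + 1)) ^ K) * ((m : ℝ) + 1) ^ K := by gcongr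
    _ = _ := by ring

end Weights

/-! ### Counting the pairings that keep the clusters of a fixed set small -/

section Pairings

open Finset Equiv

variable {H V : Type*} [Fintype H] [DecidableEq H] [DecidableEq V]

theorem card_filter_comp_le {v : H → V} {d : ℕ} (hd : ∀ x, #{h | v h = x} ≤ d) {U : Finset H}
    {T : Finset V} {τ : ℕ} (hT : #T ≤ τ) : #{h ∈ U | v h ∈ T} ≤ τ * d := by
  calc #{h ∈ U | v h ∈ T} ≤ d * #T := by
        refine card_le_mul_card_image_of_maps_to (f := v) (fun h hh => (mem_filter.1 hh).2) d ?_
        intro x _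
        exact (card_le_card (filter_subset_filter _ (subset_univ _))).trans (hd x)
    _ ≤ τ * d := by rw [mul_comm]; gcongr

open scoped Classical in
theorem card_admissible_le {v : H → V} {d : ℕ} (hd : ∀ x, #{h | v h = x} ≤ d) (S : Finset V)
    (τ : ℕ) {c θ : ℝ} (hc0 : 0 ≤ c) (hc1 : c ≤ 1) (hθ0 : 0 < θ) (hθ1 : θ ≤ 1)
    (hθ : θ * Real.exp 2 ≤ (1 - c) / 2) {N : ℕ} (U : Finset H) (hU : #U ≤ N) (f : V → V) :
    (#{σ ∈ pairingsOn U | Admissible v S τ f σ} : ℝ) ≤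
      numPairings #U * (θ⁻¹ ^ #(S.image f) * weight c N #{h ∈ U | v h ∈ S})
        * ((#U : ℝ) + 1) ^ (9 * (τ * d)) := by
  induction hm : #U using Nat.strong_induction_on generalizing U f with
  | _ m ih =>
  have hθi : 1 ≤ θ⁻¹ := (one_le_inv₀ hθ0).2 hθ1
  -- With no half-edge left at `S` the weight is 1, and counting all pairings suffices.
  by_cases hA : #{h ∈ U | v h ∈ S} = 0
  · have h1 : (#{σ ∈ pairingsOn U | Admissible v S τ f σ} : ℝ) ≤ numPairings m := by
      rw [← hm, ← card_pairingsOn]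
      exact_mod_cast card_filter_le _ _
    have h2 : 1 ≤ θ⁻¹ ^ #(S.image f) := one_le_pow₀ hθi
    have h3 : (1 : ℝ) ≤ ((m : ℝ) + 1) ^ (9 * (τ * d)) := one_le_pow₀ (by simp)
    rw [hA]
    simp only [weight, Nat.cast_zero, zero_mul, zero_div, mul_zero, neg_zero, Real.exp_zero,
      mul_one]
    refine h1.trans ?_
    rw [mul_assoc]
    refine le_mul_of_one_le_right (by positivity) ?_
    nlinarith
  -- Otherwise an admissible pairing exists, which forces the current class of `v a` to have at most
  -- `τ` vertices.
  by_cases hE : #{σ ∈ pairingsOn U | Admissible v S τ f σ} = 0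
  · rw [hE, Nat.cast_zero]
    have := weight_pos c N #{h ∈ U | v h ∈ S}
    positivity
  obtain ⟨a, haU⟩ := card_pos.1 (Nat.pos_of_ne_zero hA)
  obtain ⟨haU, haS⟩ := mem_filter.1 haU
  obtain ⟨σ₀, hσ₀⟩ := card_pos.1 (Nat.pos_of_ne_zero hE)
  obtain ⟨hσ₀, hadm⟩ := mem_filter.1 hσ₀
  have hm2 : 2 ≤ m := by
    have := card_erase_erase haU (apply_mem_erase hσ₀ haU)
    omega
  obtain ⟨m, rfl⟩ : ∃ k, m = k + 2 := ⟨m - 2, by omega⟩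
  set s := #{h ∈ U | v h ∈ S} with hs
  set q := #(S.image f) with hq
  set C := 9 * (τ * d) with hC
  -- The relative cost of the partner `b` of `a`. The factor `θ` is the class lost in a merger.
  set w : H → ℝ := fun b => if v b ∈ S then
    (if f (v b) = f (v a) then weight c N (s - 2) else θ * weight c N (s - 2))
    else weight c N (s - 1) with hw
  have hcardA : ∀ b ∈ U.erase a, v b ∈ S →
      (#{h ∈ (U.erase a).erase b | v h ∈ S} : ℝ) = s - 2 := by
    intro b hb hbS
    have h1 : a ∈ U.filter (fun h => v h ∈ S) := mem_filter.2 ⟨haU, haS⟩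
    have h2 : b ∈ (U.filter (fun h => v h ∈ S)).erase a :=
      mem_erase.2 ⟨(mem_erase.1 hb).1, mem_filter.2 ⟨(mem_erase.1 hb).2, hbS⟩⟩
    have h3 := card_erase_erase h1 h2
    rw [filter_erase, filter_erase, hs, ← h3]
    push_cast; ring
  have hcardB : ∀ b ∈ U.erase a, v b ∉ S →
      (#{h ∈ (U.erase a).erase b | v h ∈ S} : ℝ) = s - 1 := by
    intro b hb hbS
    have h1 : a ∈ U.filter (fun h => v h ∈ S) := mem_filter.2 ⟨haU, haS⟩
    have h2 : b ∉ (U.filter (fun h => v h ∈ S)).erase a := by simp [hbS]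
    have h3 := card_erase_add_one h1
    rw [filter_erase, filter_erase, erase_eq_of_notMem h2, hs, ← h3]
    push_cast; ring
  have hfib : ∀ b ∈ U.erase a,
      (#{σ ∈ {σ ∈ pairingsOn U | Admissible v S τ f σ} | σ a = b} : ℝ) ≤
        numPairings m * θ⁻¹ ^ q * ((m : ℝ) + 1) ^ C * w b := by
    intro b hb
    have hc := card_erase_erase haU hb
    have hcm : #((U.erase a).erase b) = m := by omega
    have hinj : ∀ f' : V → V, (∀ σ ∈ pairingsOn U, Admissible v S τ f σ → σ a = b →
        Admissible v S τ f' (swap a b * σ)) →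
        (#{σ ∈ {σ ∈ pairingsOn U | Admissible v S τ f σ} | σ a = b} : ℝ) ≤
        numPairings m * (θ⁻¹ ^ #(S.image f') *
          weight c N #{h ∈ (U.erase a).erase b | v h ∈ S}) * ((m : ℝ) + 1) ^ C := by
      intro f' hf'
      refine le_trans ?_ (ih m (by omega) ((U.erase a).erase b) (by omega) f' hcm)
      norm_cast
      refine card_le_card_of_injOn (fun σ => swap a b * σ) ?_ ?_
      · intro σ hσ
        simp only [coe_filter, mem_filter, Set.mem_ofPred_eq] at hσ ⊢
        obtain ⟨⟨h1, h2⟩, h3⟩ := hσ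
        refine ⟨?_, hf' σ h1 h2 h3⟩
        have := swap_mul_mem_pairingsOn_erase h1 haU
        rwa [h3] at this
      · intro σ _ ρ _ h
        exact mul_left_cancel h
    have hsame := hinj f (fun σ h1 h2 h3 => by
      have := h2.swap_mul (mem_pairingsOn.1 h1).1 a
      rwa [h3] at this)
    by_cases hbS : v b ∈ S
    · rw [hcardA b hb hbS] at hsame hinj
      by_cases hab : f (v b) = f (v a)
      · simp only [hw, if_pos hbS, if_pos hab]
        exact hsame.trans_eq (by ring)
      · simp only [hw, if_pos hbS, if_neg hab]
        refine (hinj (mergeLabels f (v a) (v b)) (fun σ h1 h2 h3 => ?_)).trans_eq ?_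
        · have := h2.swap_mul_mergeLabels (mem_pairingsOn.1 h1).1 haS (by rwa [h3])
          rwa [h3] at this
        · rw [hq, ← image_mergeLabels haS hbS hab, pow_succ]
          field_simp
    · rw [hcardB b hb hbS] at hsame
      simp only [hw, if_neg hbS]
      exact hsame.trans_eq (by ring)
  have hmaps : Set.MapsTo (fun σ : Perm H => σ a)
      ({σ ∈ pairingsOn U | Admissible v S τ f σ} : Finset (Perm H)) (U.erase a : Finset H) :=
    fun σ hσ => apply_mem_erase (mem_filter.1 hσ).1 haU
  rw [card_eq_sum_card_fiberwise hmaps]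
  push_cast
  refine (sum_le_sum hfib).trans ?_
  rw [← mul_sum]
  have hsum : ∑ b ∈ U.erase a, w b ≤ weight c N s * ((m : ℝ) + 1 + C) := by
    set o := #{b ∈ {b ∈ U.erase a | v b ∈ S} | f (v b) = f (v a)} with ho
    have hoK : o ≤ τ * d := by
      refine le_trans (card_le_card fun b hb => ?_)
        (card_filter_comp_le hd (U := U) (hadm.card_class_le haS))
      simp only [mem_filter, mem_erase] at hb ⊢
      exact ⟨hb.1.1.2, hb.1.2, hb.2⟩
    have hcs : #{b ∈ U.erase a | v b ∈ S} + 1 = s := by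
      rw [filter_erase]
      exact card_erase_add_one (mem_filter.2 ⟨haU, haS⟩)
    have hct : #{b ∈ U.erase a | v b ∈ S} + #{b ∈ U.erase a | v b ∉ S} = m + 1 := by
      rw [card_filter_add_card_filter_not, card_erase_of_mem haU, hm]; rfl
    have hco : o + #{b ∈ {b ∈ U.erase a | v b ∈ S} | ¬ f (v b) = f (v a)}
        = #{b ∈ U.erase a | v b ∈ S} := card_filter_add_card_filter_not _
    have hsm : s ≤ m + 2 := hm ▸ card_filter_le _ _
    simp only [hw]
    rw [sum_ite, sum_ite, sum_const, sum_const, sum_const]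
    simp only [nsmul_eq_mul]
    rw [← ho]
    have r1 : (#{b ∈ {b ∈ U.erase a | v b ∈ S} | ¬ f (v b) = f (v a)} : ℝ) = s - 1 - o := by
      rw [← hcs, ← hco]; push_cast; ring
    have r2 : (#{b ∈ U.erase a | v b ∉ S} : ℝ) = ((m + 2 : ℕ) : ℝ) - s := by
      have : (#{b ∈ U.erase a | v b ∈ S} : ℝ) + #{b ∈ U.erase a | v b ∉ S} = m + 1 := by
        exact_mod_cast hct
      rw [← hcs]; push_cast; linarith
    rw [r1, r2]
    have := weight_step_le (u := ((m + 2 : ℕ) : ℝ)) (s := s) (N := N) (o := o)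
      (K := ((τ * d : ℕ) : ℝ)) hc0 hc1 hθ0.le hθ (by push_cast; linarith [m.cast_nonneg (α := ℝ)])
      (by exact_mod_cast Nat.pos_of_ne_zero hA) (by exact_mod_cast hsm)
      (by rw [← hm]; exact_mod_cast hU) (by positivity) (by exact_mod_cast hoK)
    refine le_trans (le_of_eq ?_) (this.trans_eq ?_)
    · ring
    · rw [hC]; push_cast; ring
  have hW := weight_pos c N s
  have hpow := add_mul_pow_le (m := m) (K := C)
  have hnp : (numPairings (m + 2) : ℝ) = (m + 1) * numPairings m := by
    rw [numPairings]; push_cast; ring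
  rw [hnp]
  have hcast : (m : ℝ) + 2 + 1 = (m : ℝ) + 3 := by ring
  rw [hcast]
  calc _ ≤ numPairings m * θ⁻¹ ^ q * ((m : ℝ) + 1) ^ C * (weight c N s * ((m : ℝ) + 1 + C)) := by
        gcongr
    _ = numPairings m * θ⁻¹ ^ q * weight c N s * (((m : ℝ) + 1 + C) * ((m : ℝ) + 1) ^ C) := by ring
    _ ≤ numPairings m * θ⁻¹ ^ q * weight c N s * (((m : ℝ) + 1) * ((m : ℝ) + 3) ^ C) := by gcongr
    _ = _ := by ring

end Pairings

/-! ### From percolation sets to admissible pairings, and the union bound -/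

section Graph

open Finset

variable {n d : ℕ}

/-- Label each vertex by a representative of its component in the graph induced on all of `S`.
Restricting these classes to `T` only shrinks them. -/
theorem IsPercolationSet.admissible {σ : Pairing n d} {τ : ℕ} {S : Set (Fin n)}
    (hS : IsPercolationSet σ.toGraph τ S) {T : Finset (Fin n)} (hT : (T : Set (Fin n)) ⊆ S) :
    Admissible Prod.fst T τ id σ.1 := by
  let r : Setoid (Fin n) :=
    { r := Relation.ReflTransGen (σ.toGraph.induce S).Adj
      iseqv := ⟨fun _ => .refl, fun h => symm_of (Relation.ReflTransGen _) h,
        fun h h' => h.trans h'⟩ }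
  have hg : ∀ x y : Fin n, (Quotient.mk r x).out = (Quotient.mk r y).out ↔
      Relation.ReflTransGen (σ.toGraph.induce S).Adj x y := fun x y => by
    rw [Quotient.out_inj, Quotient.eq]; rfl
  refine ⟨fun x => (Quotient.mk r x).out, fun x _ y _ h => by rw [id, id] at h; rw [h],
    fun h h1 h2 => ?_, fun x hx => ?_⟩
  · exact (hg _ _).2 (.single ⟨s(h, σ.1 h), ⟨h, rfl, rfl, rfl⟩, hT h1, hT h2⟩)
  · have h1 := hS.2 x (hT hx)
    rw [← Nat.cast_le (α := ℕ∞), ← Set.encard_coe_eq_coe_finsetCard]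
    refine (Set.encard_le_encard fun y hy => ?_).trans h1
    simp only [coe_filter, Set.mem_ofPred_eq] at hy
    exact ⟨hT hy.1, (hg _ _).1 hy.2.symm⟩

/-- Admissibility passes to subsets of a percolation set, so a dense one can be cut down to exactly
`⌈β n⌉` vertices. The union bound then needs a single size. -/
theorem exists_admissible_of_lt_percDensity {σ : Pairing n d} {τ : ℕ} {β : ℝ} (hβ : 0 ≤ β)
    (hn : 0 < n) (h : β < percDensity τ σ.toGraph) :
    ∃ T : Finset (Fin n), #T = ⌈β * n⌉₊ ∧ Admissible Prod.fst T τ id σ.1 := by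
  by_contra! hno
  refine h.not_ge (Real.sSup_le ?_ hβ)
  rintro r ⟨S, hS, rfl⟩
  by_contra! hlt
  have hV : (σ.toGraph.vertexSet.ncard : ℝ) = n := by
    change ((Set.univ : Set (Fin n)).ncard : ℝ) = n
    simp [Set.ncard_univ]
  rw [hV, lt_div_iff₀ (by exact_mod_cast hn)] at hlt
  have hc : ⌈β * n⌉₊ ≤ #(S.toFinite.toFinset) := by
    rw [← Set.ncard_eq_toFinset_card]
    exact Nat.ceil_le.2 hlt.le
  obtain ⟨T, hT, hcard⟩ := exists_subset_card_eq hc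
  exact hno T hcard (hS.admissible fun x hx => (Set.Finite.mem_toFinset _).1 (hT hx))

theorem Pairing.mem_pairingsOn (σ : Pairing n d) : σ.1 ∈ pairingsOn univ :=
  SmallClusters.mem_pairingsOn.2 ⟨fun x => (σ.2 x).1, fun x => by simpa using (σ.2 x).2⟩

noncomputable instance : Fintype (Pairing n d) := by
  classical
  unfold Pairing
  infer_instance

theorem card_pairing : Fintype.card (Pairing n d) = numPairings (n * d) := by
  have h := card_pairingsOn (univ : Finset (HalfEdge n d))
  rw [card_univ, Fintype.card_prod, Fintype.card_fin, Fintype.card_fin] at h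
  rw [← h, ← card_univ]
  refine card_bij (fun σ _ => σ.1) (fun σ _ => σ.mem_pairingsOn)
    (fun _ _ _ _ h => Subtype.ext h) fun σ hσ => ?_
  rw [SmallClusters.mem_pairingsOn] at hσ
  exact ⟨⟨σ, fun x => ⟨hσ.1 x, (hσ.2 x).2 (mem_univ x)⟩⟩, mem_univ _, rfl⟩

open scoped Classical in
theorem card_lt_percDensity_le {τ : ℕ} {β c θ : ℝ} (hβ : 0 ≤ β) (hn : 0 < n)
    (hc0 : 0 ≤ c) (hc1 : c ≤ 1) (hθ0 : 0 < θ) (hθ1 : θ ≤ 1)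
    (hθ : θ * Real.exp 2 ≤ (1 - c) / 2) {k : ℕ} (hk : k = ⌈β * n⌉₊) :
    (#{σ : Pairing n d | β < percDensity τ σ.toGraph} : ℝ) ≤
      n.choose k * (numPairings (n * d) * (θ⁻¹ ^ k * weight c ((n * d : ℕ) : ℝ) ((k * d : ℕ) : ℝ))
        * (((n * d : ℕ) : ℝ) + 1) ^ (9 * (τ * d))) := by
  have h1 : #{σ : Pairing n d | β < percDensity τ σ.toGraph} ≤
      ∑ T ∈ powersetCard k (univ : Finset (Fin n)),
        #{σ ∈ pairingsOn (univ : Finset (HalfEdge n d)) | Admissible Prod.fst T τ id σ} := by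
    refine le_trans (card_le_card_of_injOn (fun σ => σ.1) (t := (powersetCard k
      (univ : Finset (Fin n))).biUnion fun T => {σ ∈ pairingsOn (univ : Finset (HalfEdge n d)) |
        Admissible Prod.fst T τ id σ}) (fun σ hσ => ?_) fun _ _ _ _ h => Subtype.ext h)
      card_biUnion_le
    simp only [coe_filter, Set.mem_ofPred_eq, mem_univ, true_and] at hσ
    obtain ⟨T, hT, hadm⟩ := exists_admissible_of_lt_percDensity hβ hn hσ
    simp only [coe_biUnion, Set.mem_iUnion]
    exact ⟨T, mem_coe.2 (mem_powersetCard.2 ⟨subset_univ _, hT.trans hk.symm⟩),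
      mem_coe.2 (mem_filter.2 ⟨σ.mem_pairingsOn, hadm⟩)⟩
  have hcu : #(univ : Finset (HalfEdge n d)) = n * d := by
    rw [card_univ, Fintype.card_prod, Fintype.card_fin, Fintype.card_fin]
  have h2 : ∀ T ∈ powersetCard k (univ : Finset (Fin n)),
      (#{σ ∈ pairingsOn (univ : Finset (HalfEdge n d)) | Admissible Prod.fst T τ id σ} : ℝ) ≤
        numPairings (n * d) * (θ⁻¹ ^ k * weight c ((n * d : ℕ) : ℝ) ((k * d : ℕ) : ℝ))
        * (((n * d : ℕ) : ℝ) + 1) ^ (9 * (τ * d)) := by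
    intro T hT
    have hTk := (mem_powersetCard.1 hT).2
    have hd : ∀ x : Fin n, #{h : HalfEdge n d | h.1 = x} ≤ d := by
      intro x
      have : ({h : HalfEdge n d | h.1 = x} : Finset _) = {x} ×ˢ univ := by
        ext ⟨a, b⟩; simp [eq_comm]
      rw [this, card_product]; simp
    have h := card_admissible_le hd T τ hc0 hc1 hθ0 hθ1 hθ univ hcu.le id
    have hs : ({h : HalfEdge n d | h.1 ∈ T} : Finset _) = T ×ˢ univ := by
      ext ⟨a, b⟩; simp
    rw [hcu, hs, card_product, image_id, hTk, card_univ, Fintype.card_fin] at h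
    exact h
  have h3 := sum_le_sum h2
  rw [sum_const, card_powersetCard, card_univ, Fintype.card_fin, nsmul_eq_mul,
    ← Nat.cast_sum] at h3
  exact (Nat.cast_le.2 h1).trans h3

end Graph

/-! ### First moment estimates and the limit -/

theorem choose_le_pow {n k : ℕ} {β : ℝ} (hβ : 0 < β) (hk0 : 0 < k) (hk : β * n ≤ k) :
    (n.choose k : ℝ) ≤ Real.exp (k * (1 - Real.log β)) := by
  have hk' : (0 : ℝ) < k := by exact_mod_cast hk0
  calc (n.choose k : ℝ) ≤ (n : ℝ) ^ k / (k.factorial : ℝ) := Nat.choose_le_pow_div k n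
    _ ≤ (k / β) ^ k / (k.factorial : ℝ) := by
      gcongr
      rw [le_div_iff₀ hβ]; linarith
    _ = (β⁻¹) ^ k * ((k : ℝ) ^ k / (k.factorial : ℝ)) := by
      rw [div_eq_mul_inv (k : ℝ) β, mul_pow]; ring
    _ ≤ (β⁻¹) ^ k * Real.exp k := by
      gcongr
      exact Real.pow_div_factorial_le_exp _ hk'.le _
    _ = _ := by
      rw [mul_sub, Real.exp_sub, mul_one, ← Real.log_pow, Real.exp_log (by positivity), inv_pow]
      field_simp

theorem firstMoment_le {n d k : ℕ} {β c θ : ℝ} (hβ : 0 < β) (hn : 0 < n) (hd : 0 < d)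
    (hc0 : 0 ≤ c) (hc1 : c ≤ 1) (hθ0 : 0 < θ) (hk0 : 0 < k) (hk : β * n ≤ k)
    (hβd : 3 - Real.log β - Real.log θ ≤ c * (β * d / 2)) :
    (n.choose k : ℝ) * (θ⁻¹ ^ k * weight c ((n * d : ℕ) : ℝ) ((k * d : ℕ) : ℝ)) ≤
      Real.exp (-(β * n)) := by
  have hn' : (1 : ℝ) ≤ n := by exact_mod_cast hn
  have hd' : (0 : ℝ) < d := by exact_mod_cast hd
  have hk' : (0 : ℝ) < k := by exact_mod_cast hk0
  have h1 := choose_le_pow hβ hk0 hk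
  have h2 : θ⁻¹ ^ k = Real.exp (k * -Real.log θ) := by
    rw [mul_neg, Real.exp_neg, ← Real.log_pow, Real.exp_log (by positivity), inv_pow]
  have h3 : weight c ((n * d : ℕ) : ℝ) ((k * d : ℕ) : ℝ) ≤
      Real.exp (k * (1 - c * (β * d / 2))) := by
    rw [weight]
    apply Real.exp_le_exp.2
    have e : -(c * (((k * d : ℕ) : ℝ) * (((k * d : ℕ) : ℝ) - 1) / (2 * ((n * d : ℕ) : ℝ)))) =
        k * (c / (2 * n) - c * (k / n * d / 2)) := by
      push_cast; field_simp; ring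
    rw [e]
    -- The cost of having `s - 1` rather than `s` in the weight; it is one of the three units in
    -- `hβd`. Another is the `1` from `choose_le_pow`, and the last leaves the decay `exp (-k)`.
    have e2 : c / (2 * n) ≤ 1 := by
      rw [div_le_one (by linarith)]; linarith
    have e3 : β ≤ k / n := by rwa [le_div_iff₀ (by linarith)]
    gcongr
  rw [h2]
  calc _ ≤ Real.exp (k * (1 - Real.log β)) * (Real.exp (k * -Real.log θ) *
        Real.exp (k * (1 - c * (β * d / 2)))) := by
        have := weight_pos c ((n * d : ℕ) : ℝ) ((k * d : ℕ) : ℝ)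
        gcongr
    _ = Real.exp (k * (2 - Real.log β - Real.log θ - c * (β * d / 2))) := by
        rw [← Real.exp_add, ← Real.exp_add]; congr 1; ring
    _ ≤ _ := by
        apply Real.exp_le_exp.2
        nlinarith

open scoped Classical in
theorem configurationModel_lt_percDensity_le {n d τ : ℕ} {β c θ : ℝ} (hβ : 0 < β) (hn : 0 < n)
    (hd : 0 < d) (hnd : Even (n * d)) (hc0 : 0 ≤ c) (hc1 : c ≤ 1) (hθ0 : 0 < θ) (hθ1 : θ ≤ 1)
    (hθ : θ * Real.exp 2 ≤ (1 - c) / 2)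
    (hβd : 3 - Real.log β - Real.log θ ≤ c * (β * d / 2)) :
    configurationModel n d {σ | β < percDensity τ σ.toGraph} ≤
      ENNReal.ofReal ((((n * d : ℕ) : ℝ) + 1) ^ (9 * (τ * d)) * Real.exp (-(β * n))) := by
  have hpos : (0 : ℝ) < numPairings (n * d) := by exact_mod_cast numPairings_pos hnd
  have hk : β * n ≤ (⌈β * n⌉₊ : ℝ) := Nat.le_ceil _
  have hk0 : 0 < ⌈β * n⌉₊ := Nat.ceil_pos.2 (by positivity)
  have h1 := card_lt_percDensity_le (d := d) (τ := τ) hβ.le hn hc0 hc1 hθ0 hθ1 hθ rfl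
  have h2 := firstMoment_le hβ hn hd hc0 hc1 hθ0 hk0 hk hβd
  rw [configurationModel, uniformOn_univ, card_pairing,
    Measure.count_apply (by trivial)]
  have hset : {σ : Pairing n d | β < percDensity τ σ.toGraph} =
      (({σ : Pairing n d | β < percDensity τ σ.toGraph} : Finset (Pairing n d)) : Set _) := by
    simp
  rw [hset, Set.encard_coe_eq_coe_finsetCard]
  have hcast : ∀ m : ℕ, (m : ENNReal) = ENNReal.ofReal m := fun m =>
    (ENNReal.ofReal_natCast m).symm
  simp only [ENat.toENNReal_coe]
  rw [hcast, hcast, ← ENNReal.ofReal_div_of_pos hpos]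
  apply ENNReal.ofReal_le_ofReal
  rw [div_le_iff₀ hpos]
  refine h1.trans ?_
  calc _ = ((n.choose ⌈β * n⌉₊ : ℝ) * (θ⁻¹ ^ ⌈β * n⌉₊ *
        weight c ((n * d : ℕ) : ℝ) ((⌈β * n⌉₊ * d : ℕ) : ℝ))) *
        ((((n * d : ℕ) : ℝ) + 1) ^ (9 * (τ * d)) * numPairings (n * d)) := by ring
    _ ≤ Real.exp (-(β * n)) *
        ((((n * d : ℕ) : ℝ) + 1) ^ (9 * (τ * d)) * numPairings (n * d)) := by gcongr
    _ = _ := by ring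

theorem tendsto_poly_mul_exp_neg {d : ℕ} (hd : 0 < d) {β : ℝ} (hβ : 0 < β) (C : ℕ) :
    Tendsto (fun n : ℕ => (((n * d : ℕ) : ℝ) + 1) ^ C * Real.exp (-(β * n))) atTop (𝓝 0) := by
  have hd' : (0 : ℝ) < d := by exact_mod_cast hd
  have h1 : Tendsto (fun n : ℕ => β * (n : ℝ) + β / d) atTop atTop :=
    tendsto_atTop_add_const_right _ _ (tendsto_natCast_atTop_atTop.const_mul_atTop hβ)
  have h2 := ((Real.tendsto_pow_mul_exp_neg_atTop_nhds_zero C).comp h1).const_mul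
    ((d / β) ^ C * Real.exp (β / d))
  rw [mul_zero] at h2
  refine h2.congr fun n => ?_
  have e1 : ((n * d : ℕ) : ℝ) + 1 = (d / β) * (β * n + β / d) := by
    push_cast; field_simp
  have e2 : Real.exp (-(β * n)) = Real.exp (β / d) * Real.exp (-(β * n + β / d)) := by
    rw [← Real.exp_add]; congr 1; ring
  rw [e1, e2, mul_pow, Function.comp]
  ring

end SmallClusters

/-! ### Choice of constants and conclusion -/

theorem corollary2 :
    ∀ ε : ℝ, 0 < ε → ∃ d₀ : ℕ, ∀ τ : ℕ, 1 ≤ τ → ∀ d : ℕ, d₀ ≤ d →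
      Tendsto
        (fun n : ℕ => SmallClusters.configurationModel n d
          {σ | SmallClusters.percDensity τ σ.toGraph ≤ (2 + ε) * (Real.log d / d)})
        (atTop ⊓ 𝓟 {n : ℕ | Even (n * d)}) (𝓝 1) := by
  intro ε hε
  -- Chosen so that `c β d / 2 = (1 + ε / 4) log d`, while `c < 1` leaves room for a positive `θ`.
  obtain ⟨c, hc⟩ : ∃ c : ℝ, c = (1 + ε / 4) / (1 + ε / 2) := ⟨_, rfl⟩
  have hc0 : 0 ≤ c := by rw [hc]; positivity
  have hc1 : c < 1 := by rw [hc, div_lt_one (by positivity)]; linarith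
  obtain ⟨θ, hθ⟩ : ∃ θ : ℝ, θ = (1 - c) / 2 / Real.exp 2 := ⟨_, rfl⟩
  have hθ0 : 0 < θ := by
    rw [hθ]
    have : 0 < 1 - c := by linarith
    positivity
  have hθ1 : θ ≤ 1 := by
    rw [hθ, div_le_one (Real.exp_pos _)]
    linarith [Real.add_one_le_exp (2 : ℝ)]
  have hθe : θ * Real.exp 2 ≤ (1 - c) / 2 := by
    rw [hθ, div_mul_cancel₀ _ (Real.exp_pos _).ne']
  -- The `1` gives `log d ≥ 1`, hence `β ≥ 1 / d`; the other term makes the surplus `(ε / 4) log d`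
  -- at least `3 - log θ`.
  refine ⟨⌈Real.exp (max 1 (4 * (3 - Real.log θ) / ε))⌉₊, fun τ _ d hd => ?_⟩
  have hd1 : Real.exp (max 1 (4 * (3 - Real.log θ) / ε)) ≤ d := Nat.ceil_le.1 hd
  have hd' : (0 : ℝ) < d := (Real.exp_pos _).trans_le hd1
  have hd0 : 0 < d := by exact_mod_cast hd'
  have hL := (Real.le_log_iff_exp_le hd').2 hd1
  have hL1 : 1 ≤ Real.log d := (le_max_left _ _).trans hL
  have hL2 : 4 * (3 - Real.log θ) ≤ Real.log d * ε :=
    (div_le_iff₀ hε).1 ((le_max_right _ _).trans hL)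
  obtain ⟨β, hβ⟩ : ∃ β : ℝ, β = (2 + ε) * (Real.log d / d) := ⟨_, rfl⟩
  have hβ0 : 0 < β := by rw [hβ]; positivity
  have hβd : 3 - Real.log β - Real.log θ ≤ c * (β * d / 2) := by
    have e1 : c * (β * d / 2) = (1 + ε / 4) * Real.log d := by
      rw [hc, hβ]; field_simp
    have e2 : -Real.log β ≤ Real.log d := by
      rw [← Real.log_inv]
      apply Real.log_le_log (by positivity)
      rw [hβ, inv_le_comm₀ (by positivity) hd', inv_eq_one_div, mul_div_assoc']
      gcongr
      nlinarith
    rw [e1]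
    linarith
  rw [← hβ]
  have hlim := SmallClusters.tendsto_poly_mul_exp_neg hd0 hβ0 (9 * (τ * d))
  have hlim' := ENNReal.Tendsto.sub (tendsto_const_nhds (x := (1 : ENNReal)))
    (ENNReal.tendsto_ofReal hlim) (Or.inl ENNReal.one_ne_top)
  rw [ENNReal.ofReal_zero, tsub_zero] at hlim'
  refine tendsto_of_tendsto_of_tendsto_of_le_of_le' (hlim'.mono_left inf_le_left)
    tendsto_const_nhds ?_ ?_
  all_goals
    filter_upwards [mem_inf_of_left (eventually_ge_atTop 1), mem_inf_of_right (mem_principal_self _)]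
      with n hn hnd
    have hne : Nonempty (SmallClusters.Pairing n d) := by
      rw [← Fintype.card_pos_iff, SmallClusters.card_pairing]
      exact SmallClusters.numPairings_pos hnd
    have hprob : IsProbabilityMeasure (SmallClusters.configurationModel n d) :=
      isProbabilityMeasure_uniformOn Set.finite_univ Set.univ_nonempty
  · have h1 := SmallClusters.configurationModel_lt_percDensity_le (τ := τ) hβ0 hn hd0 hnd hc0
      hc1.le hθ0 hθ1 hθe hβd
    have h2 : {σ : SmallClusters.Pairing n d | SmallClusters.percDensity τ σ.toGraph ≤ β} =
        {σ | β < SmallClusters.percDensity τ σ.toGraph}ᶜ := by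
      ext; simp
    rw [h2, prob_compl_eq_one_sub (by trivial)]
    gcongr
  · exact prob_le_one
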